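/- Let $X_1,X_2,\dots$ be i.i.d. real-valued random variables with continuous distribution, that is, $P(X_1=x)=0$ for every $x\in\mathbb R$. For complex powers use the principal branch, $z^q=\exp(q\log z)$ with $\operatorname{Im}\log z\in(-\pi,\pi]$ for $z\neq0$, and $0^q=0$ for $q>0$. Let $n\ge 2$ and let $\alpha\in\mathbb C$ with $\operatorname{Im}\alpha\ge0$. For $p\in(0,1]$ let $f_p(z)=f^{(\alpha)}_p(z):=(z+\alpha)^p$, which is an injective function of $z\in\mathbb C$, and put $$M^{f_p}_n:=f_p^{-1}\Bigl(\frac1n\sum_{j=1}^n f_p(X_j)\Bigr),\qquad G^{(\alpha)}_n:=\prod_{j=1}^n (X_j+\alpha)^{1/n}-\alpha .$$ Assume that, for some $\ell>0$, $E\bigl[|X_1+\alpha|^{1-\eta}\bigr]=O(\eta^{-\ell})$ as $\eta\to0+$ (in particular this expectation is finite for all sufficiently small $\eta>0$). Then $$\lim_{p\to0+}\frac{n^{1/p}M^{f_p}_n-n\,M^{f_1}_n}{n^{1/p}-n}=G^{(\alpha)}_n$$ almost surely and in $L^1$, where $p$ runs through the real numbers. Convergence in $L^1$ means that $G^{(\alpha)}_n$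 is integrable, the quotient is integrable for all sufficiently small $p>0$, and the expected absolute value of their difference tends to $0$. -/

import Mathlib

open MeasureTheory ProbabilityTheory Filter Topology Asymptotics

/-- The generator `z ↦ (z + α) ^ p` of the power mean, with the principal branch of the power
(argument in `(-π, π]`, and `0 ^ p = 0` for `p ≠ 0`). -/
noncomputable def powerGen (α : ℂ) (p : ℝ) (z : ℂ) : ℂ := (z + α) ^ (p : ℂ)

/-- For `0 < p ≤ 1` the generator is injective on the whole complex plane, so its inverse is
unambiguous on its range, whichever domain inside `ℂ` the generator is restricted to. -/
theorem powerGen_injective (α : ℂ) {p : ℝ} (hp : 0 < p) (hp1 : p ≤ 1) :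
    Function.Injective (powerGen α p) := by
  have key : ∀ w : ℂ, (w ^ (p : ℂ)) ^ ((p⁻¹ : ℝ) : ℂ) = w := by
    intro w
    have him : (Complex.log w * (p : ℂ)).im = w.arg * p := by
      simp [Complex.mul_im, Complex.log_im]
    have h1 : -Real.pi < w.arg * p := by
      nlinarith [Complex.neg_pi_lt_arg w, Real.pi_pos]
    have h2 : w.arg * p ≤ Real.pi := by
      nlinarith [Complex.arg_le_pi w, Real.pi_pos]
    rw [← Complex.cpow_mul _ (by rw [him]; exact h1) (by rw [him]; exact h2)]
    rw [← Complex.ofReal_mul, mul_inv_cancel₀ hp.ne', Complex.ofReal_one, Complex.cpow_one]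
  intro x y h
  have h' := congrArg (fun w : ℂ => w ^ ((p⁻¹ : ℝ) : ℂ)) h
  simp only [powerGen, key] at h'
  exact add_right_cancel h'

/-- The quasi-arithmetic mean `f⁻¹ ((1 / n) * ∑ f (x j))` of the first `n` terms of a real
sequence `x`, for an injective generator `f`. -/
noncomputable def quasiArithMean (f : ℂ → ℂ) (n : ℕ) (x : ℕ → ℝ) : ℂ :=
  Function.invFun f ((1 / (n : ℂ)) * ∑ j ∈ Finset.range n, f (x j : ℂ))

/-- The complex-valued geometric mean `∏ (x j + α) ^ (1 / n) - α` of the first `n` terms. -/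
noncomputable def geomMean (α : ℂ) (n : ℕ) (x : ℕ → ℝ) : ℂ :=
  (∏ j ∈ Finset.range n, ((x j : ℂ) + α) ^ (1 / (n : ℂ))) - α

/-- The normalized truncated power mean
`(n ^ (1 / p) * M_p - n * M_1) / (n ^ (1 / p) - n)`, where `M_p` is the quasi-arithmetic mean
with generator `z ↦ (z + α) ^ p`. -/
noncomputable def truncatedPowerMean (α : ℂ) (n : ℕ) (p : ℝ) (x : ℕ → ℝ) : ℂ :=
  (((n : ℝ) ^ (1 / p) : ℝ) * quasiArithMean (powerGen α p) n x
      - (n : ℂ) * quasiArithMean (powerGen α 1) n x)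
    / ((((n : ℝ) ^ (1 / p) : ℝ) : ℂ) - (n : ℂ))

/-! Put $Z_j = X_j+\alpha$, in the closed upper half-plane. The powers $Z_j^p$ lie in the sector
$0\le\arg\le p\pi$, which is stable under sums, so for $p<1$ the inverse generator is the principal
power $1/p$ and the quotient plus $\alpha$ is $\bigl((\sum Z_j^p)^{1/p}-\sum Z_j\bigr)/(n^{1/p}-n)$.

Almost surely no $Z_j$ vanishes. Then $\log\frac1n\sum Z_j^p$ has derivative $\frac1n\sum\log Z_j$
at $p=0$, while $n^{1/p}\to\infty$ removes $\sum Z_j$ (`tendsto_truncatedPowerMean`).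

For $L^1$ the difficulty is that $E|Z_1|$ may be infinite; subtracting $\sum Z_j$ cancels the
dominant term. Let $|Z_i|$ be maximal and $k\ne i$. If $|Z_k|^p\ge|Z_i|^p/2$, both parts of the
numerator are at most a constant times $n^{1/p}|Z_i|^{1-c}|Z_k|^c$ with $c=1/(2n)$ independent of
$p$. Otherwise the mean value inequality bounds the numerator by $\frac2p(n-\frac12)^{1/p}\sum_{j\ne
i}|Z_i|^{1-p}|Z_j|^p$. Both bounds are controlled by `crossSum`, whose expectation factorizes by
independence into moments of order below one (`norm_sum_cpow_sub_sum_le`, `integrable_crossSum`).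
The first gives a fixed integrable majorant; the second has expectation
$O(\frac1p\kappa^{1/p}p^{-\ell})\to0$ with $\kappa=(n-\frac12)/n<1$. A variant of dominated
convergence concludes (`tendsto_integral_zero_of_le_add`). -/

/-! ### Sectors and principal powers -/

theorem Complex.arg_mem_Icc_iff {θ : ℝ} (h0 : 0 < θ) (hπ : θ < Real.pi) (w : ℂ) :
    w.arg ∈ Set.Icc 0 θ ↔ 0 ≤ w.im ∧ w.im * Real.cos θ ≤ w.re * Real.sin θ := by
  have key : w.im * Real.cos θ - w.re * Real.sin θ = ‖w‖ * Real.sin (w.arg - θ) := by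
    rw [Real.sin_sub]
    conv_lhs => rw [← Complex.norm_mul_sin_arg w, ← Complex.norm_mul_cos_arg w]
    ring
  constructor
  · rintro ⟨h1, h2⟩
    refine ⟨Complex.arg_nonneg_iff.mp h1, ?_⟩
    have : Real.sin (w.arg - θ) ≤ 0 :=
      Real.sin_nonpos_of_nonpos_of_neg_pi_le (by linarith) (by linarith)
    nlinarith [norm_nonneg w]
  · rintro ⟨h1, h2⟩
    refine ⟨Complex.arg_nonneg_iff.mpr h1, ?_⟩
    by_contra! h
    have hw : w ≠ 0 := by
      rintro rfl
      simp at h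
      linarith
    have hs : 0 < Real.sin (w.arg - θ) :=
      Real.sin_pos_of_pos_of_lt_pi (by linarith) (by linarith [Complex.arg_le_pi w])
    have := mul_pos (norm_pos_iff.mpr hw) hs
    linarith

/-- For $\theta<\pi$ the sector is an intersection of two half-planes through the origin, hence a
convex cone. -/
theorem Complex.arg_sum_mem_Icc {ι : Type*} {θ : ℝ} (h0 : 0 < θ) (hπ : θ < Real.pi)
    (t : Finset ι) (w : ι → ℂ) (h : ∀ j ∈ t, (w j).arg ∈ Set.Icc 0 θ) :
    (∑ j ∈ t, w j).arg ∈ Set.Icc 0 θ := by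
  simp only [Complex.arg_mem_Icc_iff h0 hπ] at h ⊢
  rw [Complex.im_sum, Complex.re_sum, Finset.sum_mul, Finset.sum_mul]
  exact ⟨Finset.sum_nonneg fun j hj => (h j hj).1, Finset.sum_le_sum fun j hj => (h j hj).2⟩

theorem Complex.arg_cpow_real (z : ℂ) {p : ℝ} (hp : 0 < p) (hp1 : p ≤ 1) :
    (z ^ (p : ℂ)).arg = p * z.arg := by
  rcases eq_or_ne z 0 with rfl | hz
  · have : (p : ℂ) ≠ 0 := by exact_mod_cast hp.ne'
    simp [Complex.zero_cpow this]
  · have him : (Complex.log z * (p : ℂ)).im = z.arg * p := by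
      simp [Complex.mul_im, Complex.log_im]
    rw [Complex.cpow_def_of_ne_zero hz, ← Complex.log_im, Complex.log_exp, him, mul_comm]
    · rw [him]; nlinarith [Complex.neg_pi_lt_arg z, Real.pi_pos]
    · rw [him]; nlinarith [Complex.arg_le_pi z, Real.pi_pos]

theorem Complex.arg_cpow_real_mem_Icc {z : ℂ} (hz : 0 ≤ z.im) {p : ℝ} (hp : 0 < p) (hp1 : p ≤ 1) :
    (z ^ (p : ℂ)).arg ∈ Set.Icc 0 (p * Real.pi) := by
  rw [Complex.arg_cpow_real z hp hp1]
  have := Complex.arg_nonneg_iff.mpr hz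
  exact ⟨by positivity, by gcongr; exact Complex.arg_le_pi z⟩

theorem Complex.cpow_real_inv_cpow {w : ℂ} {p : ℝ} (hp : 0 < p)
    (hw : w.arg ∈ Set.Icc 0 (p * Real.pi)) : (w ^ ((1 / p : ℝ) : ℂ)) ^ (p : ℂ) = w := by
  have him : (Complex.log w * ((1 / p : ℝ) : ℂ)).im = w.arg / p := by
    rw [Complex.im_mul_ofReal, Complex.log_im, mul_one_div]
  have h1 : 0 ≤ w.arg / p := div_nonneg hw.1 hp.le
  have h2 : w.arg / p ≤ Real.pi := by
    rw [div_le_iff₀ hp]; linarith [hw.2]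
  rw [← Complex.cpow_mul _ (by rw [him]; linarith [Real.pi_pos]) (by rw [him]; exact h2),
    ← Complex.ofReal_mul, one_div_mul_cancel hp.ne', Complex.ofReal_one, Complex.cpow_one]

theorem Complex.cpow_real_cpow_inv (z : ℂ) {p : ℝ} (hp : 0 < p) (hp1 : p ≤ 1) :
    (z ^ (p : ℂ)) ^ ((1 / p : ℝ) : ℂ) = z := by
  have him : (Complex.log z * (p : ℂ)).im = z.arg * p := by
    simp [Complex.mul_im, Complex.log_im]
  rw [← Complex.cpow_mul _ _ _, ← Complex.ofReal_mul, mul_one_div_cancel hp.ne',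
    Complex.ofReal_one, Complex.cpow_one]
  · rw [him]; nlinarith [Complex.neg_pi_lt_arg z, Real.pi_pos]
  · rw [him]; nlinarith [Complex.arg_le_pi z, Real.pi_pos]

theorem Complex.real_mul_cpow {r : ℝ} (hr : 0 < r) (w : ℂ) {s : ℝ} (hs : s ≠ 0) :
    ((r : ℂ) * w) ^ (s : ℂ) = ((r ^ s : ℝ) : ℂ) * w ^ (s : ℂ) := by
  have hs' : (s : ℂ) ≠ 0 := by exact_mod_cast hs
  have hr' : (r : ℂ) ≠ 0 := by exact_mod_cast hr.ne'
  rcases eq_or_ne w 0 with rfl | hw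
  · simp [Complex.zero_cpow hs']
  · rw [Complex.ofReal_cpow hr.le, Complex.cpow_def_of_ne_zero (mul_ne_zero hr' hw),
      Complex.log_ofReal_mul hr hw, add_mul, Complex.exp_add, Complex.cpow_def_of_ne_zero hr',
      Complex.cpow_def_of_ne_zero hw, Complex.ofReal_log hr.le]

/-! ### Closed form of the quotient -/

/-- The average of the `p`-th powers, raised to the power `1 / p`. -/
noncomputable def cpowMean (n : ℕ) (p : ℝ) (z : ℕ → ℂ) : ℂ :=
  ((1 / (n : ℂ)) * ∑ j ∈ Finset.range n, z j ^ (p : ℂ)) ^ ((1 / p : ℝ) : ℂ)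

/-- The average stays in the sector of angle $p\pi<\pi$, so its principal power $1/p$ gives a
genuine preimage; injectivity then determines `Function.invFun`. -/
theorem quasiArithMean_powerGen {α : ℂ} (hα : 0 ≤ α.im) {n : ℕ} (hn : n ≠ 0) {p : ℝ} (hp : 0 < p)
    (hp1 : p < 1) (x : ℕ → ℝ) :
    quasiArithMean (powerGen α p) n x = cpowMean n p (fun j => x j + α) - α := by
  have harg : ((1 / (n : ℂ)) * ∑ j ∈ Finset.range n, ((x j : ℂ) + α) ^ (p : ℂ)).arg
      ∈ Set.Icc 0 (p * Real.pi) := by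
    have h1 : (1 / (n : ℂ)) = ((1 / (n : ℝ) : ℝ) : ℂ) := by push_cast; rfl
    rw [h1, Complex.arg_real_mul _ (by positivity)]
    refine Complex.arg_sum_mem_Icc (by positivity) (by nlinarith [Real.pi_pos]) _ _ fun j _ => ?_
    exact Complex.arg_cpow_real_mem_Icc (by simpa using hα) hp hp1.le
  have hval : powerGen α p (cpowMean n p (fun j => x j + α) - α)
      = (1 / (n : ℂ)) * ∑ j ∈ Finset.range n, powerGen α p (x j : ℂ) := by
    simp only [powerGen, cpowMean, sub_add_cancel]
    exact Complex.cpow_real_inv_cpow hp harg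
  rw [quasiArithMean, ← hval, Function.leftInverse_invFun (powerGen_injective α hp hp1.le)]

theorem quasiArithMean_powerGen_one (α : ℂ) {n : ℕ} (hn : n ≠ 0) (x : ℕ → ℝ) :
    n * quasiArithMean (powerGen α 1) n x = ∑ j ∈ Finset.range n, ((x j : ℂ) + α) - n * α := by
  have hn' : (n : ℂ) ≠ 0 := by exact_mod_cast hn
  have hval : powerGen α 1 ((1 / (n : ℂ)) * ∑ j ∈ Finset.range n, ((x j : ℂ) + α) - α)
      = (1 / (n : ℂ)) * ∑ j ∈ Finset.range n, powerGen α 1 (x j : ℂ) := by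
    simp [powerGen]
  rw [quasiArithMean, ← hval,
    Function.leftInverse_invFun (powerGen_injective α one_pos le_rfl)]
  field_simp

theorem natCast_lt_rpow_one_div {n : ℕ} (hn : 2 ≤ n) {p : ℝ} (hp : 0 < p) (hp1 : p < 1) :
    (n : ℝ) < (n : ℝ) ^ (1 / p) := by
  have hn1 : (1 : ℝ) < n := by exact_mod_cast hn
  conv_lhs => rw [← Real.rpow_one (n : ℝ)]
  exact Real.rpow_lt_rpow_of_exponent_lt hn1 ((one_lt_div hp).mpr hp1)

theorem truncatedPowerMean_eq {α : ℂ} (hα : 0 ≤ α.im) {n : ℕ} (hn : 2 ≤ n) {p : ℝ} (hp : 0 < p)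
    (hp1 : p < 1) (x : ℕ → ℝ) :
    truncatedPowerMean α n p x =
      (((n : ℝ) ^ (1 / p) : ℝ) * cpowMean n p (fun j => x j + α)
        - ∑ j ∈ Finset.range n, ((x j : ℂ) + α)) / ((((n : ℝ) ^ (1 / p) : ℝ) : ℂ) - (n : ℂ)) - α := by
  have hn0 : n ≠ 0 := by omega
  have hne : (((n : ℝ) ^ (1 / p) : ℝ) : ℂ) - (n : ℂ) ≠ 0 := by
    have := natCast_lt_rpow_one_div hn hp hp1
    rw [sub_ne_zero]
    exact_mod_cast this.ne'
  rw [truncatedPowerMean, quasiArithMean_powerGen hα hn0 hp hp1, quasiArithMean_powerGen_one α hn0]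
  rw [eq_sub_iff_add_eq, div_add' _ _ _ hne]
  ring

theorem rpow_mul_cpowMean {n : ℕ} (hn : n ≠ 0) {p : ℝ} (hp : 0 < p) (z : ℕ → ℂ) :
    (((n : ℝ) ^ (1 / p) : ℝ) : ℂ) * cpowMean n p z =
      (∑ j ∈ Finset.range n, z j ^ (p : ℂ)) ^ ((1 / p : ℝ) : ℂ) := by
  have hn' : (n : ℂ) ≠ 0 := by exact_mod_cast hn
  rw [cpowMean, ← Complex.real_mul_cpow (by positivity) _ (by positivity)]
  congr 1
  push_cast
  field_simp

/-! ### Pointwise limit -/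

theorem tendsto_cpowMean {n : ℕ} (hn : n ≠ 0) (z : ℕ → ℂ) (hz : ∀ j ∈ Finset.range n, z j ≠ 0) :
    Tendsto (fun p : ℝ => cpowMean n p z) (𝓝[>] 0)
      (𝓝 (∏ j ∈ Finset.range n, z j ^ (1 / (n : ℂ)))) := by
  have hn' : (n : ℂ) ≠ 0 := by exact_mod_cast hn
  set h : ℂ → ℂ := fun p => (1 / (n : ℂ)) * ∑ j ∈ Finset.range n, z j ^ p with hh
  have h0 : h 0 = 1 := by simp [hh, hn']
  set L : ℂ := (1 / (n : ℂ)) * ∑ j ∈ Finset.range n, Complex.log (z j) with hL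
  have hd : HasDerivAt h L 0 := by
    refine HasDerivAt.const_mul _ (HasDerivAt.fun_sum fun j hj => ?_)
    simpa using (hasDerivAt_id (0 : ℂ)).const_cpow (c := z j) (Or.inl (hz j hj))
  have hd' : HasDerivAt (fun p => Complex.log (h p)) L 0 := by
    simpa [h0] using hd.clog (by simp [h0])
  have hd'' := hd'.comp_ofReal (z := (0 : ℝ))
  -- Since $\log h(0)=0$, the slope is $p^{-1}\log h(p)$, the exponent in the definition of the
  -- principal power.
  have hs := hd''.tendsto_slope_zero_right
  have hlim := (Complex.continuous_exp.tendsto L).comp hs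
  have hexp : Complex.exp L = ∏ j ∈ Finset.range n, z j ^ (1 / (n : ℂ)) := by
    rw [hL, Finset.mul_sum, Complex.exp_sum]
    refine Finset.prod_congr rfl fun j hj => ?_
    rw [Complex.cpow_def_of_ne_zero (hz j hj), mul_comm]
  rw [hexp] at hlim
  refine hlim.congr' ?_
  have hcont : Tendsto (fun p : ℝ => h p) (𝓝[>] 0) (𝓝 1) := by
    have := hd.continuousAt.tendsto
    rw [h0] at this
    exact (this.comp ((Complex.continuous_ofReal.tendsto' 0 0 (by simp)))).mono_left
      nhdsWithin_le_nhds
  filter_upwards [hcont.eventually_ne one_ne_zero] with p hp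
  have hp' : (1 / (n : ℂ)) * ∑ j ∈ Finset.range n, z j ^ (p : ℂ) ≠ 0 := hp
  simp only [Function.comp, cpowMean]
  rw [Complex.cpow_def_of_ne_zero hp']
  simp [hh, hn', mul_comm]

theorem tendsto_natCast_rpow_one_div {n : ℕ} (hn : 2 ≤ n) :
    Tendsto (fun p : ℝ => (n : ℝ) ^ (1 / p)) (𝓝[>] 0) atTop := by
  have hn1 : (1 : ℝ) < n := by exact_mod_cast hn
  simp only [one_div]
  exact (tendsto_rpow_atTop_of_base_gt_one _ hn1).comp tendsto_inv_nhdsGT_zero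

theorem tendsto_truncatedPowerMean {α : ℂ} (hα : 0 ≤ α.im) {n : ℕ} (hn : 2 ≤ n) (x : ℕ → ℝ)
    (hx : ∀ j ∈ Finset.range n, (x j : ℂ) + α ≠ 0) :
    Tendsto (fun p : ℝ => truncatedPowerMean α n p x) (𝓝[>] 0) (𝓝 (geomMean α n x)) := by
  have hN := tendsto_natCast_rpow_one_div hn
  have hinv : Tendsto (fun p : ℝ => (((n : ℝ) ^ (1 / p) : ℝ) : ℂ)⁻¹) (𝓝[>] 0) (𝓝 0) := by
    have := (Complex.continuous_ofReal.tendsto 0).comp (tendsto_inv_atTop_zero.comp hN)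
    simpa [Function.comp_def] using this
  have hmean := tendsto_cpowMean (n := n) (by omega) (fun j => (x j : ℂ) + α) hx
  have h1 : Tendsto (fun p : ℝ => (cpowMean n p (fun j => (x j : ℂ) + α)
      - (((n : ℝ) ^ (1 / p) : ℝ) : ℂ)⁻¹ * ∑ j ∈ Finset.range n, ((x j : ℂ) + α))
      / (1 - (((n : ℝ) ^ (1 / p) : ℝ) : ℂ)⁻¹ * n) - α) (𝓝[>] 0)
      (𝓝 (geomMean α n x)) := by
    have := ((hmean.sub (hinv.mul_const (∑ j ∈ Finset.range n, ((x j : ℂ) + α)))).div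
      ((tendsto_const_nhds (x := (1 : ℂ))).sub (hinv.mul_const (n : ℂ))) (by simp)).sub_const α
    simpa [geomMean] using this
  refine h1.congr' ?_
  filter_upwards [Ioo_mem_nhdsGT (show (0 : ℝ) < 1 by norm_num)] with p hp
  have hlt := natCast_lt_rpow_one_div hn hp.1 hp.2
  have hne : (((n : ℝ) ^ (1 / p) : ℝ) : ℂ) - (n : ℂ) ≠ 0 := by
    rw [sub_ne_zero]
    exact_mod_cast hlt.ne'
  have hne0 : (((n : ℝ) ^ (1 / p) : ℝ) : ℂ) ≠ 0 := by
    have : (0 : ℝ) < (n : ℝ) ^ (1 / p) := lt_of_le_of_lt (by positivity) hlt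
    exact_mod_cast this.ne'
  rw [truncatedPowerMean_eq hα hn hp.1 hp.2]
  generalize (((n : ℝ) ^ (1 / p) : ℝ) : ℂ) = N at hne hne0 ⊢
  congr 1
  rw [← mul_div_mul_left _ _ hne0]
  congr 1 <;> field_simp

/-! ### Deterministic bounds by cross terms -/

/-- Mean value inequality on the convex part of a disc in the right half-plane, away from the branch
cut. -/
theorem Complex.norm_cpow_real_sub_le {s : ℝ} (hs : 1 ≤ s) {R : ℝ} {v w : ℂ}
    (hv : 0 < v.re) (hw : 0 < w.re) (hvR : ‖v‖ ≤ R) (hwR : ‖w‖ ≤ R) :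
    ‖w ^ (s : ℂ) - v ^ (s : ℂ)‖ ≤ s * R ^ (s - 1) * ‖w - v‖ := by
  have hconv : Convex ℝ ({u : ℂ | 0 < u.re} ∩ Metric.closedBall 0 R) :=
    (convex_halfSpace_re_gt 0).inter (convex_closedBall 0 R)
  refine hconv.norm_image_sub_le_of_norm_hasDerivWithin_le (f := fun u : ℂ => u ^ (s : ℂ))
    (f' := fun u => (s : ℂ) * u ^ ((s : ℂ) - 1)) (fun u hu => ?_) (fun u hu => ?_)
    ⟨hv, by simpa using hvR⟩ ⟨hw, by simpa using hwR⟩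
  · exact (Complex.hasStrictDerivAt_cpow_const (Or.inl hu.1)).hasDerivAt.hasDerivWithinAt
  · have huR : ‖u‖ ≤ R := by simpa using hu.2
    have h1 : ((s : ℂ) - 1) = ((s - 1 : ℝ) : ℂ) := by push_cast; rfl
    rw [norm_mul, h1, Complex.norm_cpow_real, Complex.norm_of_nonneg (by linarith)]
    gcongr

theorem Complex.re_cpow_real_nonneg {z : ℂ} (hz : 0 ≤ z.im) {p : ℝ} (hp : 0 < p) (hp1 : p ≤ 1 / 2) :
    0 ≤ (z ^ (p : ℂ)).re := by
  have h := Complex.arg_cpow_real_mem_Icc hz hp (by linarith)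
  rw [← Complex.abs_arg_le_pi_div_two_iff, abs_of_nonneg h.1]
  nlinarith [h.2, Real.pi_pos]

theorem Complex.re_cpow_real_pos {z : ℂ} (hz : 0 ≤ z.im) (hz0 : z ≠ 0) {p : ℝ} (hp : 0 < p)
    (hp1 : p < 1 / 2) : 0 < (z ^ (p : ℂ)).re := by
  have h := Complex.arg_cpow_real_mem_Icc hz hp (by linarith)
  have h1 : |(z ^ (p : ℂ)).arg| < Real.pi / 2 := by
    rw [abs_of_nonneg h.1]
    nlinarith [h.2, Real.pi_pos]
  rcases Complex.abs_arg_lt_pi_div_two_iff.mp h1 with h2 | h2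
  · exact h2
  · exact absurd h2 (by simp [Complex.cpow_eq_zero_iff, hz0])

theorem norm_sum_cpow_le {ι : Type*} {t : Finset ι} (z : ι → ℂ) (p : ℝ) :
    ‖∑ j ∈ t, z j ^ (p : ℂ)‖ ≤ ∑ j ∈ t, ‖z j‖ ^ p := by
  refine (norm_sum_le _ _).trans (le_of_eq ?_)
  simp only [Complex.norm_cpow_real]

/-- The sum of `a i ^ (1 - c) * a j ^ c` over the ordered pairs of distinct indices in `t`. -/
noncomputable def crossSum {ι : Type*} [DecidableEq ι] (t : Finset ι) (c : ℝ) (a : ι → ℝ) : ℝ :=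
  ∑ i ∈ t, ∑ j ∈ t.erase i, a i ^ (1 - c) * a j ^ c

theorem crossSum_nonneg {ι : Type*} [DecidableEq ι] (t : Finset ι) (c : ℝ) {a : ι → ℝ} (ha : ∀ j, 0 ≤ a j) :
    0 ≤ crossSum t c a :=
  Finset.sum_nonneg fun i _ => Finset.sum_nonneg fun j _ =>
    mul_nonneg (Real.rpow_nonneg (ha i) _) (Real.rpow_nonneg (ha j) _)

theorem rpow_mul_sum_le_crossSum {ι : Type*} [DecidableEq ι] {t : Finset ι} (c : ℝ) {a : ι → ℝ} (ha : ∀ j, 0 ≤ a j)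
    {i : ι} (hi : i ∈ t) : ∑ j ∈ t.erase i, a i ^ (1 - c) * a j ^ c ≤ crossSum t c a :=
  Finset.single_le_sum (f := fun i => ∑ j ∈ t.erase i, a i ^ (1 - c) * a j ^ c)
    (fun i _ => Finset.sum_nonneg fun j _ =>
      mul_nonneg (Real.rpow_nonneg (ha i) _) (Real.rpow_nonneg (ha j) _)) hi

theorem rpow_mul_rpow_le_crossSum {ι : Type*} [DecidableEq ι] {t : Finset ι} (c : ℝ) {a : ι → ℝ} (ha : ∀ j, 0 ≤ a j)
    {i k : ι} (hi : i ∈ t) (hk : k ∈ t) (hki : k ≠ i) :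
    a i ^ (1 - c) * a k ^ c ≤ crossSum t c a :=
  (Finset.single_le_sum (f := fun j => a i ^ (1 - c) * a j ^ c)
    (fun j _ => mul_nonneg (Real.rpow_nonneg (ha i) _) (Real.rpow_nonneg (ha j) _))
    (Finset.mem_erase.mpr ⟨hki, hk⟩)).trans (rpow_mul_sum_le_crossSum c ha hi)

theorem sum_rpow_le_of_le {ι : Type*} [DecidableEq ι] {t : Finset ι} {a : ι → ℝ} (ha : ∀ j, 0 ≤ a j) {p : ℝ} (hp : 0 ≤ p)
    {i k : ι} (hmax : ∀ j ∈ t, a j ≤ a i) (hk : k ∈ t) :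
    ∑ j ∈ t, a j ^ p ≤ (t.card - 1) * a i ^ p + a k ^ p := by
  rw [← Finset.sum_erase_add _ _ hk]
  gcongr
  calc ∑ j ∈ t.erase k, a j ^ p ≤ ∑ _j ∈ t.erase k, a i ^ p :=
        Finset.sum_le_sum fun j hj =>
          Real.rpow_le_rpow (ha j) (hmax j (Finset.mem_of_mem_erase hj)) hp
    _ = (t.card - 1) * a i ^ p := by
        rw [Finset.sum_const, nsmul_eq_mul, Finset.card_erase_of_mem hk,
          Nat.cast_sub (Finset.card_pos.mpr ⟨k, hk⟩), Nat.cast_one]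

/-- Far from the diagonal, the power sum is close to its largest term. -/
theorem norm_sum_cpow_sub_le {ι : Type*} [DecidableEq ι] {t : Finset ι} {z : ι → ℂ} (him : ∀ j ∈ t, 0 ≤ (z j).im) {i k : ι}
    (hi : i ∈ t) (hk : k ∈ t) (hki : k ≠ i) (hmax : ∀ j ∈ t, ‖z j‖ ≤ ‖z i‖) (hzi : z i ≠ 0)
    {p : ℝ} (hp : 0 < p) (hp1 : p < 1 / 2) (hy : ‖z k‖ ^ p ≤ ‖z i‖ ^ p / 2) :
    ‖(∑ j ∈ t, z j ^ (p : ℂ)) ^ ((1 / p : ℝ) : ℂ) - z i‖ ≤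
      1 / p * ((t.card : ℝ) - 1 / 2) ^ (1 / p - 1) *
        ∑ j ∈ t.erase i, ‖z i‖ ^ (1 - p) * ‖z j‖ ^ p := by
  have hcard : (2 : ℝ) ≤ t.card := by
    exact_mod_cast Finset.one_lt_card.mpr ⟨k, hk, i, hi, hki⟩
  have hr : 0 < ‖z i‖ := norm_pos_iff.mpr hzi
  have hrp : 0 < ‖z i‖ ^ p := Real.rpow_pos_of_pos hr p
  have hs : 1 ≤ 1 / p := by rw [le_div_iff₀ hp]; linarith
  have hsum := Finset.add_sum_erase t (fun j => z j ^ (p : ℂ)) hi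
  have hre : 0 ≤ (∑ j ∈ t.erase i, z j ^ (p : ℂ)).re := by
    rw [Complex.re_sum]
    exact Finset.sum_nonneg fun j hj =>
      Complex.re_cpow_real_nonneg (him j (Finset.mem_of_mem_erase hj)) hp hp1.le
  have hrei := Complex.re_cpow_real_pos (him i hi) hzi hp hp1
  -- The radius counts $n-1$ terms of size at most $\|z_i\|^p$ and one, the $k$-th, of at most half
  -- that.
  have hb := Complex.norm_cpow_real_sub_le (R := ((t.card : ℝ) - 1 / 2) * ‖z i‖ ^ p) hs
    (v := z i ^ (p : ℂ)) (w := ∑ j ∈ t, z j ^ (p : ℂ)) hrei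
    (by rw [← hsum, Complex.add_re]; linarith)
    (by rw [Complex.norm_cpow_real]; nlinarith)
    (by
      have h1 := norm_sum_cpow_le (t := t) z p
      have h2 := sum_rpow_le_of_le (fun j => norm_nonneg (z j)) hp.le hmax hk
      linarith)
  rw [Complex.cpow_real_cpow_inv _ hp (by linarith)] at hb
  refine hb.trans ?_
  have hsub : ∑ j ∈ t, z j ^ (p : ℂ) - z i ^ (p : ℂ) = ∑ j ∈ t.erase i, z j ^ (p : ℂ) := by
    rw [← hsum]; ring
  have hpow : (‖z i‖ ^ p) ^ (1 / p - 1) = ‖z i‖ ^ (1 - p) := by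
    rw [← Real.rpow_mul hr.le]
    congr 1
    field_simp
  rw [hsub, Real.mul_rpow (by linarith) hrp.le, hpow, ← Finset.mul_sum]
  have h3 := norm_sum_cpow_le (t := t.erase i) z p
  have h0 : 0 ≤ 1 / p * ((t.card : ℝ) - 1 / 2) ^ (1 / p - 1) * ‖z i‖ ^ (1 - p) := by
    have := Real.rpow_nonneg (show (0 : ℝ) ≤ (t.card : ℝ) - 1 / 2 by linarith) (1 / p - 1)
    positivity
  calc _ = (1 / p * ((t.card : ℝ) - 1 / 2) ^ (1 / p - 1) * ‖z i‖ ^ (1 - p)) *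
        ‖∑ j ∈ t.erase i, z j ^ (p : ℂ)‖ := by ring
    _ ≤ (1 / p * ((t.card : ℝ) - 1 / 2) ^ (1 / p - 1) * ‖z i‖ ^ (1 - p)) *
        ∑ j ∈ t.erase i, ‖z j‖ ^ p := by gcongr
    _ = _ := by ring

theorem norm_sum_erase_le {ι : Type*} [DecidableEq ι] {t : Finset ι} {z : ι → ℂ} {i : ι} (hmax : ∀ j ∈ t, ‖z j‖ ≤ ‖z i‖)
    {p : ℝ} (hp : 0 < p) (hp1 : p ≤ 1) :
    ‖∑ j ∈ t.erase i, z j‖ ≤ ∑ j ∈ t.erase i, ‖z i‖ ^ (1 - p) * ‖z j‖ ^ p := by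
  refine (norm_sum_le _ _).trans (Finset.sum_le_sum fun j hj => ?_)
  calc ‖z j‖ = ‖z j‖ ^ (1 - p) * ‖z j‖ ^ p := by
        rw [← Real.rpow_add_of_nonneg (norm_nonneg _) (by linarith) hp.le]; simp
    _ ≤ _ := by
        gcongr
        exact hmax j (Finset.mem_of_mem_erase hj)

/-- From $\log y\ge1-1/y\ge-2(1-y)$ on $[1/2,1]$ and $1+u\le e^u$. With $y=(a_k/a_i)^p$, the power
$1/p$ yields $(a_k/a_i)^{1/(2n)}$, whose exponent no longer depends on $p$. -/
theorem one_sub_add_div_le_rpow {n y : ℝ} (hn : 0 < n) (hy : 1 / 2 ≤ y) (hy1 : y ≤ 1) :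
    (n - 1 + y) / n ≤ y ^ (1 / (2 * n)) := by
  have hy0 : 0 < y := by linarith
  have hlog : -2 * (1 - y) ≤ Real.log y := by
    have h1 := Real.one_sub_inv_le_log_of_pos hy0
    have h2 : y⁻¹ - 1 ≤ 2 * (1 - y) := by
      rw [inv_eq_one_div, div_sub_one hy0.ne', div_le_iff₀ hy0]
      nlinarith
    linarith
  calc (n - 1 + y) / n = -((1 - y) / n) + 1 := by field_simp; ring
    _ ≤ Real.exp (-((1 - y) / n)) := Real.add_one_le_exp _
    _ ≤ Real.exp (Real.log y * (1 / (2 * n))) := by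
        rw [Real.exp_le_exp]
        have : Real.log y * (1 / (2 * n)) - -((1 - y) / n) = (Real.log y + 2 * (1 - y)) / (2 * n) := by
          field_simp
          ring
        have h3 : 0 ≤ (Real.log y + 2 * (1 - y)) / (2 * n) := div_nonneg (by linarith) (by linarith)
        linarith
    _ = y ^ (1 / (2 * n)) := by rw [Real.rpow_def_of_pos hy0]

/-- Near the diagonal, the power mean is bounded by a fixed geometric mean of two terms. -/
theorem sum_rpow_rpow_le {ι : Type*} [DecidableEq ι] {t : Finset ι} {a : ι → ℝ} (ha : ∀ j, 0 ≤ a j) {i k : ι}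
    (hk : k ∈ t) (hmax : ∀ j ∈ t, a j ≤ a i) (hai : 0 < a i)
    {p : ℝ} (hp : 0 < p) (hy : a i ^ p / 2 ≤ a k ^ p) :
    (∑ j ∈ t, a j ^ p) ^ (1 / p) ≤ (t.card : ℝ) ^ (1 / p) *
      (a i ^ (1 - 1 / (2 * (t.card : ℝ))) * a k ^ (1 / (2 * (t.card : ℝ)))) := by
  have hn : (0 : ℝ) < t.card := by exact_mod_cast Finset.card_pos.mpr ⟨k, hk⟩
  set n : ℝ := (t.card : ℝ)
  have hrp : 0 < a i ^ p := Real.rpow_pos_of_pos hai p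
  have hy1 : a k ^ p / a i ^ p ≤ 1 := by
    rw [div_le_one hrp]
    exact Real.rpow_le_rpow (ha k) (hmax k hk) hp.le
  have hy2 : 1 / 2 ≤ a k ^ p / a i ^ p := by
    rw [le_div_iff₀ hrp]; linarith
  have hle := one_sub_add_div_le_rpow hn hy2 hy1
  have hsum := sum_rpow_le_of_le ha hp.le hmax hk
  have hmain : ∑ j ∈ t, a j ^ p ≤ n * (a i ^ p * (a k ^ p / a i ^ p) ^ (1 / (2 * n))) := by
    rw [div_le_iff₀ hn] at hle
    calc _ ≤ (n - 1) * a i ^ p + a k ^ p := hsum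
      _ = a i ^ p * (n - 1 + a k ^ p / a i ^ p) := by field_simp
      _ ≤ a i ^ p * ((a k ^ p / a i ^ p) ^ (1 / (2 * n)) * n) := by gcongr
      _ = _ := by ring
  have h0 : 0 ≤ ∑ j ∈ t, a j ^ p := Finset.sum_nonneg fun j _ => Real.rpow_nonneg (ha j) _
  have hinv : ∀ x : ℝ, 0 ≤ x → (x ^ p) ^ (1 / p) = x := fun x hx => by
    rw [← Real.rpow_mul hx, mul_one_div_cancel hp.ne', Real.rpow_one]
  calc _ ≤ (n * (a i ^ p * (a k ^ p / a i ^ p) ^ (1 / (2 * n)))) ^ (1 / p) :=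
        Real.rpow_le_rpow h0 hmain (by positivity)
    _ = n ^ (1 / p) * (a i * (a k / a i) ^ (1 / (2 * n))) := by
        have hq : 0 ≤ a k / a i := div_nonneg (ha k) hai.le
        have hq' := Real.rpow_nonneg hq p
        rw [← Real.div_rpow (ha k) hai.le, Real.mul_rpow hn.le (by positivity),
          Real.mul_rpow hrp.le (by positivity), hinv _ hai.le,
          ← Real.rpow_mul hq', mul_comm (1 / (2 * n)), Real.rpow_mul hq', hinv _ hq]
    _ = _ := by
        rw [Real.div_rpow (ha k) hai.le, Real.rpow_sub hai, Real.rpow_one]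
        ring

/-- The hypothesis gives $r\le2^{1/p}b$, applied only to the factor $r^c$. This absorbs the linear
sum into the near-diagonal bound. -/
theorem le_rpow_mul_of_half_le {N : ℝ} (hN : 2 ≤ N) {r b : ℝ} (hr : 0 < r) (hb : 0 ≤ b)
    {p c : ℝ} (hp : 0 < p) (hc : 0 ≤ c) (hc1 : c ≤ 1) (hy : r ^ p / 2 ≤ b ^ p) :
    r ≤ N ^ (1 / p) * (r ^ (1 - c) * b ^ c) := by
  have h1 : r ≤ 2 ^ (1 / p) * b := by
    have h2 : r ^ p ≤ (2 ^ (1 / p) * b) ^ p := by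
      rw [Real.mul_rpow (by positivity) hb, ← Real.rpow_mul (by norm_num),
        one_div_mul_cancel hp.ne', Real.rpow_one]
      linarith
    exact (Real.rpow_le_rpow_iff hr.le (by positivity) hp).mp h2
  have h2 : (1 : ℝ) ≤ 2 ^ (1 / p) := Real.one_le_rpow (by norm_num) (by positivity)
  calc r = r ^ (1 - c) * r ^ c := by simp [← Real.rpow_add hr]
    _ ≤ r ^ (1 - c) * (2 ^ (1 / p) * b) ^ c := by gcongr
    _ = (2 ^ (1 / p)) ^ c * (r ^ (1 - c) * b ^ c) := by
        rw [Real.mul_rpow (by positivity) hb]; ring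
    _ ≤ N ^ (1 / p) * (r ^ (1 - c) * b ^ c) := by
        have h3 : ((2 : ℝ) ^ (1 / p)) ^ c ≤ N ^ (1 / p) := by
          calc ((2 : ℝ) ^ (1 / p)) ^ c ≤ ((2 : ℝ) ^ (1 / p)) ^ (1 : ℝ) := by gcongr
            _ ≤ N ^ (1 / p) := by rw [Real.rpow_one]; gcongr
        gcongr

theorem norm_sum_cpow_sub_sum_le {ι : Type*} [DecidableEq ι] {t : Finset ι} (ht : 2 ≤ t.card) {z : ι → ℂ}
    (him : ∀ j ∈ t, 0 ≤ (z j).im) (hz : ∀ j ∈ t, z j ≠ 0) {p : ℝ} (hp : 0 < p) (hp1 : p < 1 / 2) :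
    ‖(∑ j ∈ t, z j ^ (p : ℂ)) ^ ((1 / p : ℝ) : ℂ) - ∑ j ∈ t, z j‖ ≤
      (t.card + 1) * (t.card : ℝ) ^ (1 / p) *
          crossSum t (1 / (2 * (t.card : ℝ))) (fun j => ‖z j‖) +
        2 * (1 / p) * ((t.card : ℝ) - 1 / 2) ^ (1 / p) * crossSum t p (fun j => ‖z j‖) := by
  have hcard : (2 : ℝ) ≤ t.card := by exact_mod_cast ht
  have hs : 1 ≤ 1 / p := by rw [le_div_iff₀ hp]; linarith
  have hne : t.Nonempty := Finset.card_pos.mp (by omega)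
  obtain ⟨i, hi, hmax⟩ := t.exists_max_image (fun j => ‖z j‖) hne
  -- Any second index works; it need not carry the second largest modulus.
  obtain ⟨k, hk, hki⟩ := Finset.exists_mem_ne (by omega : 1 < t.card) i
  have ha : ∀ j, 0 ≤ ‖z j‖ := fun j => norm_nonneg _
  have hr : 0 < ‖z i‖ := norm_pos_iff.mpr (hz i hi)
  have hB := crossSum_nonneg t p ha
  have hA := crossSum_nonneg t (1 / (2 * (t.card : ℝ))) ha
  have hK : 1 ≤ (t.card : ℝ) - 1 / 2 := by linarith
  have hK0 : 0 < (t.card : ℝ) - 1 / 2 := by linarith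
  rcases le_total (‖z i‖ ^ p / 2) (‖z k‖ ^ p) with hy | hy
  · set c : ℝ := 1 / (2 * (t.card : ℝ)) with hc
    have hc0 : 0 ≤ c := by positivity
    have hc1 : c ≤ 1 := by rw [hc, div_le_one (by positivity)]; linarith
    have hpair := rpow_mul_rpow_le_crossSum (a := fun j => ‖z j‖) c ha hi hk hki
    have h1 : ‖(∑ j ∈ t, z j ^ (p : ℂ)) ^ ((1 / p : ℝ) : ℂ)‖ ≤
        (t.card : ℝ) ^ (1 / p) * crossSum t c (fun j => ‖z j‖) := by
      rw [Complex.norm_cpow_real]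
      calc _ ≤ (∑ j ∈ t, ‖z j‖ ^ p) ^ (1 / p) :=
            Real.rpow_le_rpow (norm_nonneg _) (norm_sum_cpow_le z p) (by positivity)
        _ ≤ _ := sum_rpow_rpow_le ha hk hmax hr hp hy
        _ ≤ _ := by gcongr
    have h2 : ‖∑ j ∈ t, z j‖ ≤
        t.card * ((t.card : ℝ) ^ (1 / p) * crossSum t c (fun j => ‖z j‖)) := by
      calc _ ≤ ∑ j ∈ t, ‖z j‖ := norm_sum_le _ _
        _ ≤ ∑ _j ∈ t, ‖z i‖ := Finset.sum_le_sum hmax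
        _ = t.card * ‖z i‖ := by rw [Finset.sum_const, nsmul_eq_mul]
        _ ≤ _ := by
            gcongr
            refine (le_rpow_mul_of_half_le hcard hr (ha k) hp hc0 hc1 hy).trans ?_
            gcongr
    have h3 : 0 ≤ 2 * (1 / p) * ((t.card : ℝ) - 1 / 2) ^ (1 / p) * crossSum t p (fun j => ‖z j‖) := by
      positivity
    linarith [norm_sub_le ((∑ j ∈ t, z j ^ (p : ℂ)) ^ ((1 / p : ℝ) : ℂ)) (∑ j ∈ t, z j)]
  · have hsum := rpow_mul_sum_le_crossSum (a := fun j => ‖z j‖) p ha hi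
    have h1 := norm_sum_cpow_sub_le him hi hk hki hmax (hz i hi) hp hp1 hy
    have h2 := norm_sum_erase_le hmax hp (by linarith)
    have h3 : ((t.card : ℝ) - 1 / 2) ^ (1 / p - 1) ≤ ((t.card : ℝ) - 1 / 2) ^ (1 / p) :=
      Real.rpow_le_rpow_of_exponent_le hK (by linarith)
    -- This factor being at least one, the linear remainder is absorbed at the cost of the constant
    -- 2.
    have h4 : 1 ≤ 1 / p * ((t.card : ℝ) - 1 / 2) ^ (1 / p) :=
      one_le_mul_of_one_le_of_one_le hs (Real.one_le_rpow hK (by positivity))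
    set S := ∑ j ∈ t.erase i, ‖z i‖ ^ (1 - p) * ‖z j‖ ^ p
    have hS : 0 ≤ S := Finset.sum_nonneg fun j _ =>
      mul_nonneg (Real.rpow_nonneg (ha i) _) (Real.rpow_nonneg (ha j) _)
    have h5 : ‖(∑ j ∈ t, z j ^ (p : ℂ)) ^ ((1 / p : ℝ) : ℂ) - ∑ j ∈ t, z j‖ ≤
        2 * (1 / p) * ((t.card : ℝ) - 1 / 2) ^ (1 / p) * S := by
      calc _ = ‖((∑ j ∈ t, z j ^ (p : ℂ)) ^ ((1 / p : ℝ) : ℂ) - z i) - ∑ j ∈ t.erase i, z j‖ := by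
            rw [← Finset.add_sum_erase t z hi]; congr 1; ring
        _ ≤ _ := norm_sub_le _ _
        _ ≤ 1 / p * ((t.card : ℝ) - 1 / 2) ^ (1 / p - 1) * S + S := add_le_add h1 h2
        _ ≤ 1 / p * ((t.card : ℝ) - 1 / 2) ^ (1 / p) * S +
            1 / p * ((t.card : ℝ) - 1 / 2) ^ (1 / p) * S := by
              gcongr
              exact le_mul_of_one_le_left hS h4
        _ = _ := by ring
    have h6 : 0 ≤ (t.card + 1) * (t.card : ℝ) ^ (1 / p) *
          crossSum t (1 / (2 * (t.card : ℝ))) (fun j => ‖z j‖) := by positivity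
    have h7 : 2 * (1 / p) * ((t.card : ℝ) - 1 / 2) ^ (1 / p) * S ≤
        2 * (1 / p) * ((t.card : ℝ) - 1 / 2) ^ (1 / p) * crossSum t p (fun j => ‖z j‖) := by
      gcongr
    linarith

/-- Every factor except one, of index $k\ne i$, is replaced by the maximal one, of index $i$. -/
theorem prod_rpow_le_crossSum {ι : Type*} [DecidableEq ι] {t : Finset ι} (ht : 2 ≤ t.card)
    {a : ι → ℝ} (ha : ∀ j, 0 ≤ a j) :
    ∏ j ∈ t, a j ^ (1 / (t.card : ℝ)) ≤ crossSum t (1 / (t.card : ℝ)) a := by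
  obtain ⟨i, hi, hmax⟩ := t.exists_max_image a (Finset.card_pos.mp (by omega))
  obtain ⟨k, hk, hki⟩ := Finset.exists_mem_ne (by omega : 1 < t.card) i
  have hn : (t.card : ℝ) ≠ 0 := by
    have : t.card ≠ 0 := by omega
    exact_mod_cast this
  refine le_trans ?_ (rpow_mul_rpow_le_crossSum _ ha hi hk hki)
  rw [← Finset.prod_erase_mul _ _ hk]
  have hk0 := Real.rpow_nonneg (ha k) (1 / (t.card : ℝ))
  gcongr
  calc ∏ j ∈ t.erase k, a j ^ (1 / (t.card : ℝ))
      ≤ ∏ _j ∈ t.erase k, a i ^ (1 / (t.card : ℝ)) :=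
        Finset.prod_le_prod (fun j _ => Real.rpow_nonneg (ha j) _) fun j hj =>
          Real.rpow_le_rpow (ha j) (hmax j (Finset.mem_of_mem_erase hj)) (by positivity)
    _ = a i ^ (1 - 1 / (t.card : ℝ)) := by
        rw [Finset.prod_const, Finset.card_erase_of_mem hk, ← Real.rpow_mul_natCast (ha i),
          Nat.cast_sub (by omega), Nat.cast_one]
        congr 1
        field_simp

theorem norm_geomMean_add_le {α : ℂ} {n : ℕ} (hn : 2 ≤ n) (x : ℕ → ℝ) :
    ‖geomMean α n x + α‖ ≤
      crossSum (Finset.range n) (1 / (n : ℝ)) (fun j => ‖(x j : ℂ) + α‖) := by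
  have h := prod_rpow_le_crossSum (t := Finset.range n) (by simpa using hn)
    (a := fun j => ‖(x j : ℂ) + α‖) fun j => norm_nonneg _
  rw [Finset.card_range] at h
  refine le_trans (le_of_eq ?_) h
  rw [geomMean, sub_add_cancel, norm_prod]
  refine Finset.prod_congr rfl fun j _ => ?_
  rw [← Complex.norm_cpow_real]
  push_cast
  rfl

theorem norm_truncatedPowerMean_add_le {α : ℂ} (hα : 0 ≤ α.im) {n : ℕ} (hn : 2 ≤ n) {p : ℝ}
    (hp : 0 < p) (hp1 : p < 1 / 2) (x : ℕ → ℝ) (hx : ∀ j ∈ Finset.range n, (x j : ℂ) + α ≠ 0) :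
    ‖truncatedPowerMean α n p x + α‖ ≤
      2 * (n + 1) * crossSum (Finset.range n) (1 / (2 * (n : ℝ))) (fun j => ‖(x j : ℂ) + α‖) +
        4 * (1 / p * (((n : ℝ) - 1 / 2) / n) ^ (1 / p)) *
          crossSum (Finset.range n) p (fun j => ‖(x j : ℂ) + α‖) := by
  have hn2 : (2 : ℝ) ≤ n := by exact_mod_cast hn
  have hn0 : (0 : ℝ) < n := by linarith
  have h := norm_sum_cpow_sub_sum_le (t := Finset.range n) (by simpa using hn)
    (z := fun j => (x j : ℂ) + α) (fun j _ => by simpa using hα) hx hp hp1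
  rw [← rpow_mul_cpowMean (by omega) hp, Finset.card_range] at h
  rw [truncatedPowerMean_eq hα hn hp (by linarith), sub_add_cancel, norm_div,
    Real.div_rpow (by linarith) hn0.le]
  -- Hence the denominator is at least $n^{1/p}/2$, which doubles the constants.
  have hN : 2 * (n : ℝ) ≤ (n : ℝ) ^ (1 / p) := by
    calc 2 * (n : ℝ) ≤ (n : ℝ) ^ (2 : ℝ) := by rw [Real.rpow_two]; nlinarith
      _ ≤ (n : ℝ) ^ (1 / p) := by
        apply Real.rpow_le_rpow_of_exponent_le (by linarith)
        rw [le_div_iff₀ hp]; linarith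
  have hK : 0 ≤ ((n : ℝ) - 1 / 2) ^ (1 / p) := Real.rpow_nonneg (by linarith) _
  have hA := crossSum_nonneg (Finset.range n) (1 / (2 * (n : ℝ)))
    (a := fun j => ‖(x j : ℂ) + α‖) fun j => norm_nonneg _
  have hB := crossSum_nonneg (Finset.range n) p
    (a := fun j => ‖(x j : ℂ) + α‖) fun j => norm_nonneg _
  have hden : ‖(((n : ℝ) ^ (1 / p) : ℝ) : ℂ) - (n : ℂ)‖ = (n : ℝ) ^ (1 / p) - n := by
    rw [← Complex.ofReal_natCast, ← Complex.ofReal_sub, Complex.norm_of_nonneg (by linarith)]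
  rw [hden]
  generalize crossSum (Finset.range n) p (fun j => ‖(x j : ℂ) + α‖) = B at *
  generalize crossSum (Finset.range n) (1 / (2 * (n : ℝ))) (fun j => ‖(x j : ℂ) + α‖) = A at *
  generalize (n : ℝ) ^ (1 / p) = N at *
  generalize ((n : ℝ) - 1 / 2) ^ (1 / p) = K at *
  have hN0 : 0 < N := by linarith
  rw [div_le_iff₀ (by linarith)]
  refine h.trans ?_
  calc _ = (2 * (n + 1) * A + 4 * (1 / p * (K / N)) * B) * (N / 2) := by field_simp; ring
    _ ≤ _ := by
      gcongr
      linarith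

/-! ### Convergence and integrability tools -/

/-- With $u=1/p$ this is $u^{1+\ell}e^{u\log\kappa}$, and $\log\kappa<0$. -/
theorem tendsto_inv_mul_rpow_inv_mul_rpow_neg {κ : ℝ} (h0 : 0 < κ) (h1 : κ < 1) (ℓ : ℝ) :
    Tendsto (fun p : ℝ => 1 / p * κ ^ (1 / p) * p ^ (-ℓ)) (𝓝[>] 0) (𝓝 0) := by
  have h := (tendsto_rpow_mul_exp_neg_mul_atTop_nhds_zero (1 + ℓ) (-Real.log κ)
    (neg_pos.mpr (Real.log_neg h0 h1))).comp tendsto_inv_nhdsGT_zero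
  refine h.congr' ?_
  filter_upwards [self_mem_nhdsWithin] with p hp
  have hp : 0 < p := hp
  have hp' : 0 < p⁻¹ := inv_pos.mpr hp
  simp only [Function.comp, neg_neg]
  rw [Real.rpow_add hp', Real.rpow_one, Real.rpow_neg hp.le, Real.inv_rpow hp.le,
    Real.rpow_def_of_pos h0, one_div]
  ring

/-- Dominated convergence handles $\min(g_i,D)$, and $g_i\le\min(g_i,D)+e_i$. -/
theorem MeasureTheory.tendsto_integral_zero_of_le_add {Ω ι : Type*} [MeasurableSpace Ω]
    {μ : Measure Ω} {l : Filter ι} [l.IsCountablyGenerated] {g e : ι → Ω → ℝ} {D : Ω → ℝ}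
    (hD : Integrable D μ) (hg : ∀ᶠ i in l, Integrable (g i) μ) (he : ∀ᶠ i in l, Integrable (e i) μ)
    (hg0 : ∀ i ω, 0 ≤ g i ω) (he0 : ∀ᶠ i in l, ∀ ω, 0 ≤ e i ω) (hD0 : ∀ ω, 0 ≤ D ω)
    (hle : ∀ᶠ i in l, ∀ᵐ ω ∂μ, g i ω ≤ D ω + e i ω)
    (hlim : ∀ᵐ ω ∂μ, Tendsto (fun i => g i ω) l (𝓝 0))
    (helim : Tendsto (fun i => ∫ ω, e i ω ∂μ) l (𝓝 0)) :
    Tendsto (fun i => ∫ ω, g i ω ∂μ) l (𝓝 0) := by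
  have hmin : Tendsto (fun i => ∫ ω, min (g i ω) (D ω) ∂μ) l (𝓝 0) := by
    have := tendsto_integral_filter_of_dominated_convergence (μ := μ) (l := l)
      (F := fun i ω => min (g i ω) (D ω)) (f := fun _ => 0) D
      (hg.mono fun i hi => hi.aestronglyMeasurable.inf hD.aestronglyMeasurable)
      (Eventually.of_forall fun i => ae_of_all _ fun ω => by
        rw [Real.norm_of_nonneg (le_min (hg0 i ω) (hD0 ω))]
        exact min_le_right _ _)
      hD (hlim.mono fun ω hω => by
        simpa [hD0 ω] using hω.min (tendsto_const_nhds (x := D ω)))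
    simpa using this
  refine tendsto_of_tendsto_of_tendsto_of_le_of_le' tendsto_const_nhds
    (by simpa using hmin.add helim) (Eventually.of_forall fun i => integral_nonneg (hg0 i)) ?_
  filter_upwards [hg, he, he0, hle] with i hgi hei he0i hlei
  have hinf : Integrable (fun ω => min (g i ω) (D ω)) μ := hgi.inf hD
  rw [← integral_add hinf hei]
  refine integral_mono_ae hgi (hinf.add hei) ?_
  filter_upwards [hlei] with ω hω
  show g i ω ≤ min (g i ω) (D ω) + e i ω
  rcases le_total (g i ω) (D ω) with h | h
  · rw [min_eq_left h]; linarith [he0i ω]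
  · rw [min_eq_right h]; exact hω

theorem MeasureTheory.Integrable.rpow_of_le {Ω : Type*} [MeasurableSpace Ω] {μ : Measure Ω}
    [IsFiniteMeasure μ] {Y : Ω → ℝ} (hY : Measurable Y) (hY0 : ∀ ω, 0 ≤ Y ω) {s r : ℝ} (hs : 0 ≤ s)
    (hsr : s ≤ r) (h : Integrable (fun ω => Y ω ^ r) μ) :
    Integrable (fun ω => Y ω ^ s) μ ∧ ∫ ω, Y ω ^ s ∂μ ≤ ∫ ω, (1 + Y ω ^ r) ∂μ := by
  have hle : ∀ ω, Y ω ^ s ≤ 1 + Y ω ^ r := fun ω => by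
    rcases le_total (Y ω) 1 with h1 | h1
    · linarith [Real.rpow_le_one (hY0 ω) h1 hs, Real.rpow_nonneg (hY0 ω) r]
    · linarith [Real.rpow_le_rpow_of_exponent_le h1 hsr]
  have hint : Integrable (fun ω => 1 + Y ω ^ r) μ := (integrable_const 1).add h
  have hI : Integrable (fun ω => Y ω ^ s) μ :=
    hint.mono' (hY.pow_const s).aestronglyMeasurable (ae_of_all _ fun ω => by
      rw [Real.norm_of_nonneg (Real.rpow_nonneg (hY0 ω) s)]
      exact hle ω)
  exact ⟨hI, integral_mono hI hint hle⟩

theorem integrable_crossSum {Ω : Type*} [MeasurableSpace Ω] {P : Measure Ω}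
    [IsProbabilityMeasure P] {Y : ℕ → Ω → ℝ} (hind : iIndepFun Y P)
    (hident : ∀ i, IdentDistrib (Y i) (Y 0) P P) {c : ℝ}
    (h1 : Integrable (fun ω => Y 0 ω ^ (1 - c)) P) (h2 : Integrable (fun ω => Y 0 ω ^ c) P)
    (t : Finset ℕ) :
    Integrable (fun ω => crossSum t c (fun j => Y j ω)) P ∧
      ∫ ω, crossSum t c (fun j => Y j ω) ∂P =
        t.card * (t.card - 1) * ((∫ ω, Y 0 ω ^ (1 - c) ∂P) * ∫ ω, Y 0 ω ^ c ∂P) := by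
  have hid : ∀ (s : ℝ) i, IdentDistrib (fun ω => Y i ω ^ s) (fun ω => Y 0 ω ^ s) P P :=
    fun s i => (hident i).comp (measurable_id.pow_const s)
  have hpair : ∀ i j, j ≠ i → Integrable (fun ω => Y i ω ^ (1 - c) * Y j ω ^ c) P ∧
      ∫ ω, Y i ω ^ (1 - c) * Y j ω ^ c ∂P
        = (∫ ω, Y 0 ω ^ (1 - c) ∂P) * ∫ ω, Y 0 ω ^ c ∂P := by
    intro i j hij
    have hI : IndepFun (fun ω => Y i ω ^ (1 - c)) (fun ω => Y j ω ^ c) P :=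
      (hind.indepFun hij.symm).comp (measurable_id.pow_const (1 - c)) (measurable_id.pow_const c)
    have hi := (hid (1 - c) i).integrable_iff.mpr h1
    have hj := (hid c j).integrable_iff.mpr h2
    refine ⟨hI.integrable_mul hi hj, ?_⟩
    rw [← (hid (1 - c) i).integral_eq, ← (hid c j).integral_eq]
    exact hI.integral_mul_eq_mul_integral hi.aestronglyMeasurable hj.aestronglyMeasurable
  have hinner : ∀ i ∈ t, ∀ j ∈ t.erase i, Integrable (fun ω => Y i ω ^ (1 - c) * Y j ω ^ c) P :=
    fun i _ j hj => (hpair i j (Finset.ne_of_mem_erase hj)).1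
  have houter : ∀ i ∈ t, Integrable (fun ω => ∑ j ∈ t.erase i, Y i ω ^ (1 - c) * Y j ω ^ c) P :=
    fun i hi => integrable_finsetSum _ (hinner i hi)
  refine ⟨integrable_finsetSum _ houter, ?_⟩
  simp only [crossSum]
  rw [integral_finsetSum _ houter]
  have hsum : ∀ i ∈ t, ∫ ω, ∑ j ∈ t.erase i, Y i ω ^ (1 - c) * Y j ω ^ c ∂P =
      (t.card - 1) * ((∫ ω, Y 0 ω ^ (1 - c) ∂P) * ∫ ω, Y 0 ω ^ c ∂P) := by
    intro i hi
    rw [integral_finsetSum _ (hinner i hi),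
      Finset.sum_congr rfl fun j hj => (hpair i j (Finset.ne_of_mem_erase hj)).2,
      Finset.sum_const, nsmul_eq_mul, Finset.card_erase_of_mem hi,
      Nat.cast_sub (Finset.card_pos.mpr ⟨i, hi⟩), Nat.cast_one]
  rw [Finset.sum_congr rfl hsum, Finset.sum_const, nsmul_eq_mul, mul_assoc]

theorem measurable_geomMean {Ω : Type*} [MeasurableSpace Ω] {X : ℕ → Ω → ℝ}
    (hX : ∀ i, Measurable (X i)) (α : ℂ) (n : ℕ) :
    Measurable fun ω => geomMean α n (fun j => X j ω) := by
  refine Measurable.sub_const (Finset.measurable_fun_prod _ fun j _ => ?_) α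
  exact ((Complex.measurable_ofReal.comp (hX j)).add_const α).pow_const _

/-- The closed form makes measurability visible, which `Function.invFun` does not. -/
theorem measurable_truncatedPowerMean {Ω : Type*} [MeasurableSpace Ω] {X : ℕ → Ω → ℝ}
    (hX : ∀ i, Measurable (X i)) {α : ℂ} (hα : 0 ≤ α.im) {n : ℕ} (hn : 2 ≤ n) {p : ℝ}
    (hp : 0 < p) (hp1 : p < 1) :
    Measurable fun ω => truncatedPowerMean α n p (fun j => X j ω) := by
  have hZ : ∀ j, Measurable fun ω => (X j ω : ℂ) + α := fun j =>
    (Complex.measurable_ofReal.comp (hX j)).add_const α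
  simp only [truncatedPowerMean_eq hα hn hp hp1, cpowMean]
  have h1 : Measurable fun ω => ∑ j ∈ Finset.range n, ((X j ω : ℂ) + α) ^ (p : ℂ) :=
    Finset.measurable_fun_sum _ fun j _ => (hZ j).pow_const _
  have h2 : Measurable fun ω => ∑ j ∈ Finset.range n, ((X j ω : ℂ) + α) :=
    Finset.measurable_fun_sum _ fun j _ => hZ j
  exact (((((h1.const_mul _).pow_const _).const_mul _).sub h2).div_const _).sub_const α

theorem ae_add_ne_zero {Ω : Type*} [MeasurableSpace Ω] {P : Measure Ω} {X : ℕ → Ω → ℝ}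
    (hident : ∀ i, IdentDistrib (X i) (X 0) P P) (hcont : ∀ x : ℝ, P {ω | X 0 ω = x} = 0)
    (α : ℂ) : ∀ᵐ ω ∂P, ∀ j, (X j ω : ℂ) + α ≠ 0 := by
  rw [ae_all_iff]
  intro j
  have h1 : P {ω | X j ω = -α.re} = 0 := by
    rw [← hcont (-α.re)]
    exact (hident j).measure_mem_eq (measurableSet_singleton (-α.re))
  refine measure_mono_null (fun ω hω => ?_) h1
  have h2 : (X j ω : ℂ) + α = 0 := by simpa using hω
  have h3 := congrArg Complex.re h2
  simp only [Complex.add_re, Complex.ofReal_re, Complex.zero_re] at h3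
  show X j ω = -α.re
  linarith

/-! ### Almost sure and $L^1$ convergence -/

theorem mainTheorem7 {Ω : Type*} [MeasurableSpace Ω] (P : Measure Ω) [IsProbabilityMeasure P]
    (X : ℕ → Ω → ℝ)
    (hmeas : ∀ i, Measurable (X i))
    (hindep : iIndepFun X P)
    (hident : ∀ i, IdentDistrib (X i) (X 0) P P)
    (hcont : ∀ x : ℝ, P {ω | X 0 ω = x} = 0)
    (n : ℕ) (hn : 2 ≤ n)
    (α : ℂ) (hα : 0 ≤ α.im)
    (ℓ : ℝ) (hℓ : 0 < ℓ)
    (hint : ∀ᶠ η : ℝ in 𝓝[>] 0, Integrable (fun ω => ‖(X 0 ω : ℂ) + α‖ ^ (1 - η)) P)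
    (hO : (fun η : ℝ => ∫ ω, ‖(X 0 ω : ℂ) + α‖ ^ (1 - η) ∂P)
      =O[𝓝[>] 0] fun η : ℝ => η ^ (-ℓ)) :
    (∀ᵐ ω ∂P, Tendsto (fun p : ℝ => truncatedPowerMean α n p (fun j => X j ω))
      (𝓝[>] 0) (𝓝 (geomMean α n (fun j => X j ω)))) ∧
    MemLp (fun ω => geomMean α n (fun j => X j ω)) 1 P ∧
    (∀ᶠ p : ℝ in 𝓝[>] 0,
      MemLp (fun ω => truncatedPowerMean α n p (fun j => X j ω)) 1 P) ∧
    Tendsto (fun p : ℝ => eLpNorm (fun ω => truncatedPowerMean α n p (fun j => X j ω)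
      - geomMean α n (fun j => X j ω)) 1 P) (𝓝[>] 0) (𝓝 0) := by
  have hn2 : (2 : ℝ) ≤ n := by exact_mod_cast hn
  have hne := ae_add_ne_zero hident hcont α
  have hlim : ∀ᵐ ω ∂P, Tendsto (fun p : ℝ => truncatedPowerMean α n p (fun j => X j ω))
      (𝓝[>] 0) (𝓝 (geomMean α n (fun j => X j ω))) := by
    filter_upwards [hne] with ω hω
    exact tendsto_truncatedPowerMean hα hn _ fun j _ => hω j
  -- moments of the shifted variables
  have hφ : Measurable fun x : ℝ => ‖(x : ℂ) + α‖ :=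
    (Complex.measurable_ofReal.add_const α).norm
  set Y : ℕ → Ω → ℝ := fun j ω => ‖(X j ω : ℂ) + α‖ with hY
  have hYm : ∀ j, Measurable (Y j) := fun j => hφ.comp (hmeas j)
  have hY0 : ∀ j ω, 0 ≤ Y j ω := fun j ω => norm_nonneg _
  have hYind : iIndepFun Y P := hindep.comp (fun _ x => ‖(x : ℂ) + α‖) fun _ => hφ
  have hYid : ∀ i, IdentDistrib (Y i) (Y 0) P P := fun i => (hident i).comp hφ
  have hmom : ∀ s : ℝ, 0 < s → s < 1 → Integrable (fun ω => Y 0 ω ^ s) P := by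
    intro s hs hs1
    obtain ⟨η, hη1, hη2⟩ :=
      (hint.and (Ioo_mem_nhdsGT (show (0 : ℝ) < 1 - s by linarith))).exists
    exact (Integrable.rpow_of_le (hYm 0) (hY0 0) hs.le (by linarith [hη2.2]) hη1).1
  have hcross : ∀ c : ℝ, 0 < c → c < 1 →
      Integrable (fun ω => crossSum (Finset.range n) c (fun j => Y j ω)) P :=
    fun c hc hc1 => (integrable_crossSum hYind hYid (hmom _ (by linarith) (by linarith))
      (hmom c hc hc1) _).1
  have hcn : ∀ (c : ℝ) ω, 0 ≤ crossSum (Finset.range n) c (fun j => Y j ω) :=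
    fun c ω => crossSum_nonneg _ _ fun j => hY0 j ω
  have hA1 := hcross (1 / (n : ℝ)) (by positivity) (by rw [div_lt_one (by linarith)]; linarith)
  have hA2 := hcross (1 / (2 * (n : ℝ))) (by positivity)
    (by rw [div_lt_one (by linarith)]; linarith)
  have hgeom : Integrable (fun ω => geomMean α n (fun j => X j ω)) P := by
    refine (hA1.add (integrable_const ‖α‖)).mono'
      (measurable_geomMean hmeas α n).aestronglyMeasurable (ae_of_all _ fun ω => ?_)
    calc ‖geomMean α n (fun j => X j ω)‖ = ‖(geomMean α n (fun j => X j ω) + α) - α‖ := by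
          rw [add_sub_cancel_right]
      _ ≤ _ := norm_sub_le _ _
      _ ≤ _ := add_le_add (norm_geomMean_add_le hn _) le_rfl
  -- the bound on the truncated power mean
  set κ : ℝ := ((n : ℝ) - 1 / 2) / n with hκ
  have hκ0 : 0 < κ := div_pos (by linarith) (by linarith)
  have hκ1 : κ < 1 := by rw [hκ, div_lt_one (by linarith)]; linarith
  set D : Ω → ℝ := fun ω =>
    2 * (n + 1) * crossSum (Finset.range n) (1 / (2 * (n : ℝ))) (fun j => Y j ω)
  have hD : Integrable D P := hA2.const_mul _
  have hD0 : ∀ ω, 0 ≤ D ω := fun ω => mul_nonneg (by positivity) (hcn _ ω)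
  set e : ℝ → Ω → ℝ := fun p ω =>
    4 * (1 / p * κ ^ (1 / p)) * crossSum (Finset.range n) p (fun j => Y j ω)
  have hsmall : ∀ᶠ p : ℝ in 𝓝[>] 0, p ∈ Set.Ioo (0 : ℝ) (1 / 2) :=
    Ioo_mem_nhdsGT (by norm_num)
  have he : ∀ p ∈ Set.Ioo (0 : ℝ) (1 / 2), Integrable (e p) P := fun p hp =>
    (hcross p hp.1 (by linarith [hp.2])).const_mul _
  have he0 : ∀ p ∈ Set.Ioo (0 : ℝ) (1 / 2), ∀ ω, 0 ≤ e p ω := fun p hp ω => by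
    have := hp.1
    exact mul_nonneg (by positivity) (hcn p ω)
  have hbound : ∀ p ∈ Set.Ioo (0 : ℝ) (1 / 2), ∀ᵐ ω ∂P,
      ‖truncatedPowerMean α n p (fun j => X j ω) + α‖ ≤ D ω + e p ω := fun p hp => by
    filter_upwards [hne] with ω hω
    exact norm_truncatedPowerMean_add_le hα hn hp.1 hp.2 _ fun j _ => hω j
  have htrunc : ∀ p ∈ Set.Ioo (0 : ℝ) (1 / 2),
      Integrable (fun ω => truncatedPowerMean α n p (fun j => X j ω)) P := fun p hp => by
    refine ((hD.add (he p hp)).add (integrable_const ‖α‖)).mono'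
      (measurable_truncatedPowerMean hmeas hα hn hp.1
        (by linarith [hp.2])).aestronglyMeasurable ?_
    filter_upwards [hbound p hp] with ω hω
    calc ‖truncatedPowerMean α n p (fun j => X j ω)‖
          = ‖(truncatedPowerMean α n p (fun j => X j ω) + α) - α‖ := by
          rw [add_sub_cancel_right]
      _ ≤ _ := norm_sub_le _ _
      _ ≤ _ := add_le_add hω le_rfl
  have helim : Tendsto (fun p => ∫ ω, e p ω ∂P) (𝓝[>] 0) (𝓝 0) := by
    -- A bound for $E\,Y_0^p$ uniform in $p\le1/2$, so that only $E\,Y_0^{1-p}$ may blow up, at the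
    -- rate given by `hO`.
    set B : ℝ := ∫ ω, (1 + Y 0 ω ^ (1 / 2 : ℝ)) ∂P
    have hM : Tendsto (fun p : ℝ => 1 / p * κ ^ (1 / p) * ∫ ω, Y 0 ω ^ (1 - p) ∂P)
        (𝓝[>] 0) (𝓝 0) :=
      ((isBigO_refl (fun p : ℝ => 1 / p * κ ^ (1 / p)) (𝓝[>] 0)).mul hO).trans_tendsto
        (tendsto_inv_mul_rpow_inv_mul_rpow_neg hκ0 hκ1 ℓ)
    have hup := hM.const_mul (4 * ((n : ℝ) * (n - 1)) * B)
    rw [mul_zero] at hup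
    refine tendsto_of_tendsto_of_tendsto_of_le_of_le' tendsto_const_nhds hup ?_ ?_
    · filter_upwards [hsmall] with p hp
      exact integral_nonneg (he0 p hp)
    · filter_upwards [hsmall] with p hp
      have hp0 := hp.1
      have hpB := (Integrable.rpow_of_le (hYm 0) (hY0 0) hp.1.le hp.2.le
        (hmom (1 / 2) (by norm_num) (by norm_num))).2
      have hI := (integrable_crossSum hYind hYid (hmom (1 - p) (by linarith [hp.2])
        (by linarith)) (hmom p hp0 (by linarith [hp.2])) (Finset.range n)).2
      rw [Finset.card_range] at hI
      have hM0 : 0 ≤ ∫ ω, Y 0 ω ^ (1 - p) ∂P :=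
        integral_nonneg fun ω => Real.rpow_nonneg (hY0 0 ω) _
      have hn1 : (0 : ℝ) ≤ n - 1 := by linarith
      calc ∫ ω, e p ω ∂P = 4 * (1 / p * κ ^ (1 / p)) * (n * (n - 1) *
            ((∫ ω, Y 0 ω ^ (1 - p) ∂P) * ∫ ω, Y 0 ω ^ p ∂P)) := by
            rw [← hI]; exact integral_const_mul _ _
        _ ≤ 4 * (1 / p * κ ^ (1 / p)) * (n * (n - 1) *
            ((∫ ω, Y 0 ω ^ (1 - p) ∂P) * B)) := by gcongr
        _ = _ := by ring
  have hL1 : Tendsto (fun p : ℝ => ∫ ω, ‖truncatedPowerMean α n p (fun j => X j ω)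
      - geomMean α n (fun j => X j ω)‖ ∂P) (𝓝[>] 0) (𝓝 0) := by
    refine tendsto_integral_zero_of_le_add (e := e) (hD.add hA1)
      (hsmall.mono fun p hp => ((htrunc p hp).sub hgeom).norm) (hsmall.mono he)
      (fun p ω => norm_nonneg _) (hsmall.mono he0) (fun ω => add_nonneg (hD0 ω) (hcn _ ω))
      (hsmall.mono fun p hp => ?_) ?_ helim
    · filter_upwards [hbound p hp] with ω hω
      calc _ = ‖(truncatedPowerMean α n p (fun j => X j ω) + α)
            - (geomMean α n (fun j => X j ω) + α)‖ := by rw [add_sub_add_right_eq_sub]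
        _ ≤ _ := norm_sub_le _ _
        _ ≤ (D ω + e p ω) + crossSum (Finset.range n) (1 / (n : ℝ)) (fun j => Y j ω) :=
            add_le_add hω (norm_geomMean_add_le hn _)
        _ = _ := add_right_comm _ _ _
    · filter_upwards [hlim] with ω hω
      exact tendsto_iff_norm_sub_tendsto_zero.mp hω
  refine ⟨hlim, memLp_one_iff_integrable.mpr hgeom,
    hsmall.mono fun p hp => memLp_one_iff_integrable.mpr (htrunc p hp), ?_⟩
  have hfin := ENNReal.tendsto_ofReal hL1
  rw [ENNReal.ofReal_zero] at hfin
  refine hfin.congr' ?_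
  filter_upwards [hsmall] with p hp
  rw [eLpNorm_one_eq_lintegral_enorm]
  exact ofReal_integral_norm_eq_lintegral_enorm ((htrunc p hp).sub hgeom)
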